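/- All Banach lattices are real. Let $F$ be a Banach lattice with positive cone $F^{+}$. A net $(y_\alpha)$ in $F$ is \emph{un-convergent} to $y\in F$ if $\big\| |y_\alpha-y|\wedge u\big\|\to 0$ for every $u\in F^{+}$, and \emph{uaw-convergent} to $y$ if $|y_\alpha-y|\wedge u\to 0$ weakly for every $u\in F^{+}$; uaw-convergence is the convergence of a topology on $F$, the \emph{uaw-topology}. Let $T\colon E\to F$ be a linear operator between Banach lattices and let $B_E$ be the closed unit ball of $E$. The operator $T$ is called - \emph{order bounded} if it maps order bounded sets to order bounded sets; - \emph{sequentially un-compact} (resp. \emph{sequentially uaw-compact}) if every sequence in $T(B_E)$ has a subsequence which is un-convergent (resp. uaw-convergent) to some element of $F$; - \emph{uaw-compact} if $T(B_E)$ is relatively compact (has compact closure) in the uaw-topology; - \emph{AM-compact} (resp. \emph{order weakly compact}) if it maps every order interval $[a,b]=\{x\in E: a\le x\le b\}$ to a relatively norm compact (resp. relatively weakly compact) subset of $F$. Proposition. Let $T\colon E\to F$ be an order bounded linear operator between Banach lattices. 1. If $T$ is sequentially un-compact, then $T$ is AM-compact. 2. If $T$ is uaw-compact, then $T$ is order weakly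 compact; likewise, if $T$ is sequentially uaw-compact, then $T$ is order weakly compact. -/

import Mathlib

open Filter Topology

section Convergence

variable {E : Type*} [NormedAddCommGroup E] [NormedSpace ℝ E] [Lattice E]

/-- Unbounded norm convergence of the net `x`, indexed along the filter `l`, to `y`. -/
def UnTendsto {ι : Type*} (x : ι → E) (l : Filter ι) (y : E) : Prop :=
  ∀ u : E, 0 ≤ u → Tendsto (fun i => ‖|x i - y| ⊓ u‖) l (𝓝 0)

/-- Unbounded absolute weak convergence of the net `x`, indexed along the filter `l`, to `y`. -/
def UawTendsto {ι : Type*} (x : ι → E) (l : Filter ι) (y : E) : Prop :=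
  ∀ u : E, 0 ≤ u → Tendsto (fun i => toWeakSpace ℝ E (|x i - y| ⊓ u)) l (𝓝 0)

/-- The filter of neighbourhoods of `y` for the `uaw`-topology: the coarsest filter along which
the identity is `uaw`-convergent to `y`. -/
noncomputable def uawNhds (y : E) : Filter E :=
  ⨅ u : {u : E // 0 ≤ u}, comap (fun z => toWeakSpace ℝ E (|z - y| ⊓ (u : E))) (𝓝 0)

variable (E) in
/-- The `uaw`-topology: a set is open iff it belongs to `uawNhds y` for each of its points `y`.
Its convergence is exactly `uaw`-convergence, see `tendsto_uawTopology_iff`. -/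
@[reducible] noncomputable def uawTopology : TopologicalSpace E :=
  TopologicalSpace.mkOfNhds uawNhds

theorem tendsto_uawNhds_iff {ι : Type*} (x : ι → E) (l : Filter ι) (y : E) :
    Tendsto x l (uawNhds y) ↔ UawTendsto x l y := by
  simp only [uawNhds, tendsto_iInf, tendsto_comap_iff, Subtype.forall, UawTendsto]
  rfl

theorem tendsto_toWeakSpace_zero_iff {ι : Type*} (x : ι → E) (l : Filter ι) :
    Tendsto (fun i => toWeakSpace ℝ E (x i)) l (𝓝 0) ↔
      ∀ f : E →L[ℝ] ℝ, Tendsto (fun i => f (x i)) l (𝓝 0) := by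
  have hinj : Function.Injective (topDualPairing ℝ E).flip := by
    intro a b hab
    refine (SeparatingDual.eq_iff_forall_dual_eq (R := ℝ)).2 fun g => ?_
    exact LinearMap.congr_fun hab g
  have h := WeakBilin.tendsto_iff_forall_eval_tendsto (topDualPairing ℝ E).flip hinj
    (f := fun i => toWeakSpace ℝ E (x i)) (l := l) (x := 0)
  refine h.trans (forall_congr' fun f => ?_)
  change Tendsto (fun i => f (x i)) l (𝓝 (f 0)) ↔ _
  rw [map_zero]

end Convergence

section Nhds

variable {E : Type*} [NormedAddCommGroup E] [NormedSpace ℝ E] [Lattice E] [HasSolidNorm E]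
  [IsOrderedAddMonoid E] [IsOrderedModule ℝ E]

/-- Every continuous functional is dominated by a positive one. -/
theorem exists_positive_dominating (f : E →L[ℝ] ℝ) :
    ∃ g : E →L[ℝ] ℝ, (∀ x, 0 ≤ x → 0 ≤ g x) ∧ ∀ x, |f x| ≤ g |x| := by
  classical
  let S : E → Set ℝ := fun x => f '' {y | |y| ≤ x}
  let p : E → ℝ := fun x => sSup (S x)
  have hbd : ∀ x, ∀ r ∈ S x, r ≤ ‖f‖ * ‖x‖ := by
    rintro x _ ⟨y, hy, rfl⟩
    have hy' : |y| ≤ |x| := le_trans hy (le_abs_self x)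
    calc f y ≤ ‖f y‖ := le_abs_self _
      _ ≤ ‖f‖ * ‖y‖ := f.le_opNorm y
      _ ≤ ‖f‖ * ‖x‖ := by gcongr; exact norm_le_norm_of_abs_le_abs hy'
  have hbdd : ∀ x, BddAbove (S x) := fun x => ⟨_, hbd x⟩
  have hne : ∀ x, 0 ≤ x → (0:ℝ) ∈ S x := fun x hx => ⟨0, by simpa using hx, map_zero f⟩
  have hp0 : ∀ x, 0 ≤ x → 0 ≤ p x := fun x hx => le_csSup (hbdd x) (hne x hx)
  have hple : ∀ x, 0 ≤ x → p x ≤ ‖f‖ * ‖x‖ := fun x hx => csSup_le ⟨0, hne x hx⟩ (hbd x)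
  have hadd : ∀ x z, 0 ≤ x → 0 ≤ z → p (x + z) = p x + p z := by
    intro x z hx hz
    apply le_antisymm
    · refine csSup_le ⟨0, hne _ (add_nonneg hx hz)⟩ ?_
      rintro _ ⟨y, hy, rfl⟩
      have h1 : y ≤ x + z := (abs_le'.1 hy).1
      have h2 : -y ≤ x + z := (abs_le'.1 hy).2
      set w := (y ⊓ x) ⊔ (-x) with hw
      have hw1 : |w| ≤ x := abs_le'.2 ⟨sup_le inf_le_right (by
        exact (neg_nonpos.2 hx).trans hx), neg_le.1 le_sup_right⟩
      have hw2 : |y - w| ≤ z := by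
        refine abs_le'.2 ⟨?_, ?_⟩
        · have : y - z ≤ w := le_sup_of_le_left (le_inf (sub_le_self _ hz) (by
            rw [sub_le_iff_le_add]; exact h1))
          rw [sub_le_comm]; exact this
        · rw [neg_sub, sub_le_iff_le_add]
          refine sup_le (inf_le_left.trans (le_add_of_nonneg_left hz)) ?_
          rw [neg_le_iff_add_nonneg]
          have := neg_le_iff_add_nonneg.1 h2
          calc 0 ≤ _ := this
            _ = _ := by abel
      have : f y = f w + f (y - w) := by rw [← map_add]; congr 1; abel
      rw [this]
      exact add_le_add (le_csSup (hbdd x) ⟨w, hw1, rfl⟩) (le_csSup (hbdd z) ⟨_, hw2, rfl⟩)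
    · rw [← le_sub_iff_add_le]
      refine csSup_le ⟨0, hne x hx⟩ ?_
      rintro _ ⟨y, hy, rfl⟩
      rw [le_sub_comm]
      refine csSup_le ⟨0, hne z hz⟩ ?_
      rintro _ ⟨y', hy', rfl⟩
      rw [le_sub_iff_add_le, ← map_add]
      refine le_csSup (hbdd _) ⟨y' + y, ?_, rfl⟩
      calc |y' + y| ≤ |y'| + |y| := abs_add_le _ _
        _ ≤ z + x := add_le_add hy' hy
        _ = x + z := add_comm _ _
  have hsmul : ∀ (c : ℝ) x, 0 < c → 0 ≤ x → p (c • x) ≤ c * p x := by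
    intro c x hc hx
    refine csSup_le ⟨0, hne _ (smul_nonneg hc.le hx)⟩ ?_
    rintro _ ⟨y, hy, rfl⟩
    have hy' : |c⁻¹ • y| ≤ x := by
      obtain ⟨h1, h2⟩ := abs_le'.1 hy
      have h3 := smul_le_smul_of_nonneg_left h1 (inv_nonneg.2 hc.le)
      have h4 := smul_le_smul_of_nonneg_left h2 (inv_nonneg.2 hc.le)
      rw [inv_smul_smul₀ hc.ne'] at h3 h4
      exact abs_le'.2 ⟨h3, by simpa using h4⟩
    have h5 : f (c⁻¹ • y) ≤ p x := le_csSup (hbdd x) ⟨_, hy', rfl⟩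
    rw [map_smul, smul_eq_mul, inv_mul_le_iff₀ hc] at h5
    exact h5
  let q : E → ℝ := fun x => p x⁺ - p x⁻
  have hq : ∀ a b, 0 ≤ a → 0 ≤ b → q (a - b) = p a - p b := by
    intro a b ha hb
    have h : (a - b)⁺ + b = a + (a - b)⁻ := by
      have := posPart_sub_negPart (a - b)
      rw [← sub_eq_zero] at this ⊢
      rw [← this]; abel
    have h' := congrArg p h
    rw [hadd _ _ (posPart_nonneg _) hb, hadd _ _ ha (negPart_nonneg _)] at h'
    simp only [q]; linarith
  have hqp : ∀ a, 0 ≤ a → q a = p a := by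
    intro a ha
    have h := hq a 0 ha le_rfl
    have h0 := hadd 0 0 le_rfl le_rfl
    rw [add_zero] at h0
    rw [sub_zero] at h
    linarith
  have hqadd : ∀ x z, q (x + z) = q x + q z := by
    intro x z
    have h : x + z = (x⁺ + z⁺) - (x⁻ + z⁻) := by
      conv_lhs => rw [← posPart_sub_negPart x, ← posPart_sub_negPart z]
      abel
    rw [h, hq _ _ (add_nonneg (posPart_nonneg _) (posPart_nonneg _))
      (add_nonneg (negPart_nonneg _) (negPart_nonneg _)),
      hadd _ _ (posPart_nonneg _) (posPart_nonneg _),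
      hadd _ _ (negPart_nonneg _) (negPart_nonneg _)]
    simp only [q]; ring
  let Q : E →+ ℝ := AddMonoidHom.mk' q hqadd
  have hQb : ∀ x, ‖Q x‖ ≤ ‖f‖ * ‖x‖ := by
    have key : ∀ x, q x ≤ ‖f‖ * ‖x‖ := by
      intro x
      have h1 := hp0 x⁻ (negPart_nonneg _)
      have h2 := hple x⁺ (posPart_nonneg _)
      have h3 : ‖x⁺‖ ≤ ‖x‖ := norm_le_norm_of_abs_le_abs (by
        rw [abs_of_nonneg (posPart_nonneg x)]; exact sup_le (le_abs_self x) (abs_nonneg x))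
      have h4 : ‖f‖ * ‖x⁺‖ ≤ ‖f‖ * ‖x‖ := by gcongr
      simp only [q]; linarith
    intro x
    rw [Real.norm_eq_abs, abs_le']
    refine ⟨key x, ?_⟩
    rw [← map_neg, ← norm_neg x]
    exact key (-x)
  have hQc : Continuous Q := AddMonoidHomClass.continuous_of_bound Q ‖f‖ hQb
  refine ⟨Q.toRealLinearMap hQc, fun x hx => ?_, fun x => ?_⟩
  · change 0 ≤ q x
    rw [hqp x hx]; exact hp0 x hx
  · change |f x| ≤ q |x|
    rw [hqp _ (abs_nonneg x), abs_le']
    exact ⟨le_csSup (hbdd _) ⟨x, le_rfl, rfl⟩,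
      le_csSup (hbdd _) ⟨-x, by simp, map_neg f x⟩⟩

/-- The `uawNhds` are the neighbourhood filters of the `uaw`-topology. -/
theorem nhds_uawTopology (y : E) : @nhds E (uawTopology E) y = uawNhds y := by
  have hmem : ∀ (g : E →L[ℝ] ℝ) (u : E), 0 ≤ u → ∀ a : E, ∀ ε : ℝ, 0 < ε →
      ∀ᶠ z in uawNhds a, g (|z - a| ⊓ u) < ε := by
    intro g u hu a ε hε
    have h := (tendsto_toWeakSpace_zero_iff _ _).1
      ((tendsto_uawNhds_iff id (uawNhds a) a).1 tendsto_id u hu) g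
    exact h.eventually_lt_const hε
  refine TopologicalSpace.nhds_mkOfNhds _ _ ?_ ?_
  · intro a
    have : UawTendsto id (pure a) a := by
      intro u hu
      simp [tendsto_pure_left, hu]
      exact fun s hs => mem_of_mem_nhds hs
    exact (tendsto_uawNhds_iff id (pure a) a).2 this
  · intro a
    suffices h : UawTendsto id ((uawNhds a).bind uawNhds) a from
      fun s hs => (tendsto_uawNhds_iff id _ a).2 h hs
    intro u hu
    rw [tendsto_toWeakSpace_zero_iff]
    intro f
    obtain ⟨g, hg, hfg⟩ := exists_positive_dominating f
    have hmono : ∀ v w : E, v ≤ w → g v ≤ g w := fun v w h => by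
      have := hg (w - v) (sub_nonneg.2 h)
      rw [map_sub] at this; linarith
    rw [Metric.tendsto_nhds]
    intro ε hε
    rw [eventually_bind]
    filter_upwards [hmem g u hu a (ε / 2) (half_pos hε)] with y hy
    filter_upwards [hmem g u hu y (ε / 2) (half_pos hε)] with z hz
    have h1 : |z - a| ⊓ u ≤ |z - y| ⊓ u + |y - a| ⊓ u := by
      rw [inf_add, add_inf, add_inf]
      refine le_inf (le_inf (inf_le_left.trans ?_) ?_) (le_inf ?_ ?_)
      · have h := abs_add_le (z - y) (y - a)
        rwa [sub_add_sub_cancel] at h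
      · exact inf_le_right.trans (le_add_of_nonneg_left (abs_nonneg _))
      · exact inf_le_right.trans (le_add_of_nonneg_right (abs_nonneg _))
      · exact inf_le_right.trans (le_add_of_nonneg_right hu)
    have h2 := hmono _ _ h1
    rw [map_add] at h2
    have h3 := hfg (|z - a| ⊓ u)
    rw [abs_of_nonneg (le_inf (abs_nonneg _) hu)] at h3
    rw [Real.dist_eq, sub_zero]
    simp only [id]
    linarith

/-- Convergence in the `uaw`-topology is `uaw`-convergence. -/
theorem tendsto_uawTopology_iff {ι : Type*} (x : ι → E) (l : Filter ι) (y : E) :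
    Tendsto x l (@nhds E (uawTopology E) y) ↔ UawTendsto x l y := by
  rw [nhds_uawTopology, tendsto_uawNhds_iff]

end Nhds

section Operators

/-- `T` is sequentially `un`-compact: the image of the closed unit ball is relatively
sequentially `un`-compact. -/
def IsSeqUnCompactOperator {X F : Type*} [NormedAddCommGroup X] [NormedSpace ℝ X]
    [NormedAddCommGroup F] [NormedSpace ℝ F] [Lattice F] (T : X →ₗ[ℝ] F) : Prop :=
  ∀ y : ℕ → F, (∀ n, y n ∈ T '' Metric.closedBall (0 : X) 1) →
    ∃ φ : ℕ → ℕ, StrictMono φ ∧ ∃ z : F, UnTendsto (y ∘ φ) atTop z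

/-- `T` is sequentially `uaw`-compact: the image of the closed unit ball is relatively
sequentially `uaw`-compact. -/
def IsSeqUawCompactOperator {X F : Type*} [NormedAddCommGroup X] [NormedSpace ℝ X]
    [NormedAddCommGroup F] [NormedSpace ℝ F] [Lattice F] (T : X →ₗ[ℝ] F) : Prop :=
  ∀ y : ℕ → F, (∀ n, y n ∈ T '' Metric.closedBall (0 : X) 1) →
    ∃ φ : ℕ → ℕ, StrictMono φ ∧ ∃ z : F, UawTendsto (y ∘ φ) atTop z

/-- `T` is `uaw`-compact: the image of the closed unit ball is relatively compact for the
`uaw`-topology. -/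
def IsUawCompactOperator {X F : Type*} [NormedAddCommGroup X] [NormedSpace ℝ X]
    [NormedAddCommGroup F] [NormedSpace ℝ F] [Lattice F] (T : X →ₗ[ℝ] F) : Prop :=
  @IsCompact F (uawTopology F) (@closure F (uawTopology F) (T '' Metric.closedBall (0 : X) 1))

/-- `T` is order bounded: it maps order bounded sets to order bounded sets. -/
def IsOrderBoundedOperator {E F : Type*} [NormedAddCommGroup E] [NormedSpace ℝ E] [Lattice E]
    [NormedAddCommGroup F] [NormedSpace ℝ F] [Lattice F] (T : E →ₗ[ℝ] F) : Prop :=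
  ∀ s : Set E, BddBelow s → BddAbove s → BddBelow (T '' s) ∧ BddAbove (T '' s)

/-- `T` is AM-compact: it maps order intervals to relatively (norm) compact sets. -/
def IsAMCompactOperator {E X : Type*} [NormedAddCommGroup E] [NormedSpace ℝ E] [Lattice E]
    [NormedAddCommGroup X] [NormedSpace ℝ X] (T : E →ₗ[ℝ] X) : Prop :=
  ∀ a b : E, IsCompact (closure (T '' Set.Icc a b))

/-- `T` is order weakly compact: it maps order intervals to relatively weakly compact sets. -/
def IsOrderWeaklyCompactOperator {E X : Type*} [NormedAddCommGroup E] [NormedSpace ℝ E]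
    [Lattice E] [NormedAddCommGroup X] [NormedSpace ℝ X] (T : E →ₗ[ℝ] X) : Prop :=
  ∀ a b : E, IsCompact (closure (toWeakSpace ℝ X '' (T '' Set.Icc a b)))

end Operators

/-! Order intervals are norm bounded and `T` is order bounded, so a positive multiple of `T '' Icc a
b` lies both in the image of the unit ball and in some `{y | |y| ≤ u}`. There truncation is
harmless: `|y - z| ≤ u + |z|`, so testing against the one element `u + |z|` recovers `|y - z|`,
whatever the limit `z`. Hence un-limits are norm limits, and uaw-limits are weak limits because a
positive functional dominates each functional.

Compactness then transfers by sequences in the norm case and by ultrafilters in the uaw case. The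
sequential uaw case needs the hard half of Eberlein–Šmulian, proved by Whitley's argument: each
point of the weak-star closure in the bidual is traced by a sequence in the set, tested on finite
norming sets of functionals. -/

/-- A finite-dimensional subspace of a dual space is normed, up to a factor `2`, by a finite
subset of the unit ball. -/
theorem exists_finset_norming {Y : Type*} [NormedAddCommGroup Y] [NormedSpace ℝ Y]
    (V : Submodule ℝ (Y →L[ℝ] ℝ)) [FiniteDimensional ℝ V] :
    ∃ S : Finset Y, (∀ f ∈ S, ‖f‖ ≤ 1) ∧
      ∀ v ∈ V, ∀ c : ℝ, 0 ≤ c → (∀ f ∈ S, |v f| ≤ c) → ‖v‖ ≤ 2 * c := by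
  classical
  have hproper : ProperSpace V := FiniteDimensional.proper ℝ V
  -- Each unit functional exceeds `1 / 2` somewhere on the ball; compactness of the sphere of `V`
  -- leaves finitely many test points.
  obtain ⟨t, ht⟩ := (isCompact_sphere (0 : V) 1).elim_finite_subcover
    (fun f : Metric.closedBall (0 : Y) 1 => {v : V | 1 / 2 < ‖(v : Y →L[ℝ] ℝ) f‖})
    (fun f => isOpen_lt continuous_const (by fun_prop)) (by
      intro v hv
      have hv1 : ‖(v : Y →L[ℝ] ℝ)‖ = 1 := mem_sphere_zero_iff_norm.1 hv
      obtain ⟨f, hf, hvf⟩ := (v : Y →L[ℝ] ℝ).exists_lt_apply_of_lt_opNorm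
        (show (1 / 2 : ℝ) < _ by rw [hv1]; norm_num)
      exact Set.mem_iUnion.2 ⟨⟨f, by simpa using hf.le⟩, hvf⟩)
  refine ⟨t.image Subtype.val, ?_, ?_⟩
  · intro f hf
    obtain ⟨g, -, rfl⟩ := Finset.mem_image.1 hf
    exact mem_closedBall_zero_iff.1 g.2
  · intro v hv c hc h
    rcases eq_or_ne v 0 with rfl | hv0
    · simpa using hc
    have hpos : 0 < ‖v‖ := norm_pos_iff.2 hv0
    have hmem : (⟨‖v‖⁻¹ • v, V.smul_mem _ hv⟩ : V) ∈ Metric.sphere (0 : V) 1 := by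
      refine (mem_sphere_zero_iff_norm (E := V)).2 ?_
      rw [Submodule.coe_norm, norm_smul, norm_inv, norm_norm, inv_mul_cancel₀ hpos.ne']
    obtain ⟨f, hf, hlt⟩ := Set.mem_iUnion₂.1 (ht hmem)
    have h1 := h f (Finset.mem_image_of_mem _ hf)
    have h2 : 1 / 2 < ‖v‖⁻¹ * |v f| := by simpa [norm_smul] using hlt
    rw [inv_mul_eq_div, lt_div_iff₀ hpos] at h2
    linarith

/-! ### Criteria for relative weak compactness -/

section WeakCompactness

variable {X : Type*} [NormedAddCommGroup X] [NormedSpace ℝ X]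

theorem tendsto_toWeakSpace_iff {ι : Type*} (x : ι → X) (l : Filter ι) (z : X) :
    Tendsto (fun i => toWeakSpace ℝ X (x i)) l (𝓝 (toWeakSpace ℝ X z)) ↔
      ∀ f : X →L[ℝ] ℝ, Tendsto (fun i => f (x i)) l (𝓝 (f z)) := by
  refine WeakBilin.tendsto_iff_forall_eval_tendsto (topDualPairing ℝ X).flip (fun a b hab => ?_)
  exact (SeparatingDual.eq_iff_forall_dual_eq (R := ℝ)).2 fun g => LinearMap.congr_fun hab g

theorem tendsto_apply_of_tendsto_smul {ι : Type*} {l : Filter ι} {y : ι → X} {c : ℝ} {z : X}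
    (hc : 0 < c) (f : X →L[ℝ] ℝ) (h : Tendsto (fun i => f (c • y i)) l (𝓝 (f z))) :
    Tendsto (fun i => f (y i)) l (𝓝 (f (c⁻¹ • z))) := by
  simpa [hc.ne'] using h.const_mul c⁻¹

/-- A weak limit lies in every closed subspace containing the net. -/
theorem mem_closure_of_tendsto_weak {ι : Type*} {l : Filter ι} [l.NeBot] {x : ι → X} {z : X}
    (W : Submodule ℝ X) (hx : ∀ i, x i ∈ W)
    (h : ∀ f : X →L[ℝ] ℝ, Tendsto (fun i => f (x i)) l (𝓝 (f z))) : z ∈ closure (W : Set X) := by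
  have h1 : toWeakSpace ℝ X z ∈ closure (toWeakSpace ℝ X '' (W : Set X)) :=
    mem_closure_of_tendsto ((tendsto_toWeakSpace_iff x l z).2 h)
      (Eventually.of_forall fun i => Set.mem_image_of_mem _ (hx i))
  -- Mazur: a convex set has the same weak and norm closure.
  rw [← W.convex.toWeakSpace_closure ℝ] at h1
  obtain ⟨y, hy, hyz⟩ := h1
  rwa [← (toWeakSpace ℝ X).injective hyz]

/-- Points of the weak-star closure in the bidual are approximated on finite sets of
functionals. -/
theorem exists_mem_approx_of_mem_closure {A : Set X} {φ : (X →L[ℝ] ℝ) →L[ℝ] ℝ}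
    (hφ : StrongDual.toWeakDual φ ∈ closure (NormedSpace.inclusionInDoubleDualWeak ℝ X ''
      (toWeakSpace ℝ X '' A))) (S : Finset (X →L[ℝ] ℝ)) {ε : ℝ} (hε : 0 < ε) :
    ∃ a ∈ A, ∀ f ∈ S, |φ f - f a| < ε := by
  have hopen : IsOpen {ψ : WeakDual ℝ (X →L[ℝ] ℝ) | ∀ f ∈ S, |φ f - ψ f| < ε} := by
    have : {ψ : WeakDual ℝ (X →L[ℝ] ℝ) | ∀ f ∈ S, |φ f - ψ f| < ε} =
        ⋂ f ∈ S, {ψ : WeakDual ℝ (X →L[ℝ] ℝ) | |φ f - ψ f| < ε} := by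
      ext; simp
    rw [this]
    refine isOpen_biInter_finset fun f _ => isOpen_lt ?_ continuous_const
    exact (continuous_const.sub (WeakDual.eval_continuous f)).abs
  obtain ⟨_, h, ⟨_, ⟨a, ha, rfl⟩, rfl⟩⟩ := mem_closure_iff.1 hφ _ hopen
    (fun f _ => by simpa using hε)
  exact ⟨a, ha, h⟩

/-- A bounded set is relatively weakly compact as soon as every ultrafilter on it converges
weakly. -/
theorem isCompact_closure_weak_of_ultrafilter {A : Set X} (hb : Bornology.IsBounded A)
    (h : ∀ U : Ultrafilter X, A ∈ U →
      ∃ z : X, ∀ f : X →L[ℝ] ℝ, Tendsto f U (𝓝 (f z))) :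
    IsCompact (closure (toWeakSpace ℝ X '' A)) := by
  -- By Banach–Alaoglu, it suffices that the weak-star closure in the bidual stays inside the copy
  -- of `X`.
  refine NormedSpace.isCompact_closure_of_isBounded ℝ X _ ?_ ?_
  · rwa [Set.preimage_image_eq _ (toWeakSpace ℝ X).injective]
  · intro ψ hψ
    let g : X → WeakDual ℝ (X →L[ℝ] ℝ) := fun x =>
      NormedSpace.inclusionInDoubleDualWeak ℝ X (toWeakSpace ℝ X x)
    have hψ' : ψ ∈ closure (g '' A) := by rwa [Set.image_image] at hψ
    obtain ⟨V, hV, hVψ⟩ := mem_closure_iff_ultrafilter.1 hψ'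
    obtain ⟨U, hUA, hUV⟩ : ∃ U : Ultrafilter X, A ∈ U ∧ U.map g = V := by
      have hne : (comap g V ⊓ 𝓟 A).NeBot := by
        rw [inf_comm, ← map_neBot_iff g, Filter.push_pull, map_principal,
          inf_eq_right.2 (le_principal_iff.2 hV)]
        exact V.neBot
      refine ⟨Ultrafilter.of (comap g V ⊓ 𝓟 A), le_principal_iff.1 ((Ultrafilter.of_le _).trans inf_le_right),
        ?_⟩
      refine Ultrafilter.coe_le_coe.1 ?_
      rw [Ultrafilter.coe_map]
      exact map_le_iff_le_comap.2 ((Ultrafilter.of_le _).trans inf_le_left)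
    obtain ⟨z, hz⟩ := h U hUA
    refine ⟨toWeakSpace ℝ X z, ?_⟩
    have h1 : Tendsto g U (𝓝 (g z)) :=
      ((NormedSpace.inclusionInDoubleDualWeak ℝ X).continuous.tendsto _).comp
        ((tendsto_toWeakSpace_iff id (U : Filter X) z).2 hz)
    have h2 : Tendsto g U (𝓝 ψ) := by
      rw [Tendsto, ← Ultrafilter.coe_map, hUV]; exact hVψ
    exact tendsto_nhds_unique h1 h2

/-- **Eberlein–Šmulian**: a bounded set in which every sequence has a weakly convergent
subsequence is relatively weakly compact. -/
theorem isCompact_closure_weak_of_seq {A : Set X} (hb : Bornology.IsBounded A)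
    (h : ∀ y : ℕ → X, (∀ n, y n ∈ A) → ∃ ψ : ℕ → ℕ, StrictMono ψ ∧
      ∃ z : X, ∀ f : X →L[ℝ] ℝ, Tendsto (fun n => f (y (ψ n))) atTop (𝓝 (f z))) :
    IsCompact (closure (toWeakSpace ℝ X '' A)) := by
  classical
  refine NormedSpace.isCompact_closure_of_isBounded ℝ X _ ?_ ?_
  · rwa [Set.preimage_image_eq _ (toWeakSpace ℝ X).injective]
  intro φ₀ hφ₀
  obtain ⟨φ, rfl⟩ := StrongDual.toWeakDual.surjective φ₀
  let J := NormedSpace.inclusionInDoubleDual ℝ X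
  -- `N P` norms the span of `φ` and `J '' P` up to the factor 2.
  have hN : ∀ P : Finset X, ∃ S : Finset (X →L[ℝ] ℝ), (∀ f ∈ S, ‖f‖ ≤ 1) ∧
      ∀ y ∈ Submodule.span ℝ (P : Set X), ∀ c : ℝ, 0 ≤ c →
        (∀ f ∈ S, |φ f - f y| ≤ c) → ‖φ - J y‖ ≤ 2 * c := by
    intro P
    have hfin : (insert φ (J '' (P : Set X))).Finite := (P.finite_toSet.image _).insert _
    have := FiniteDimensional.span_of_finite ℝ hfin
    obtain ⟨S, hS1, hS⟩ := exists_finset_norming (Submodule.span ℝ (insert φ (J '' (P : Set X))))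
    refine ⟨S, hS1, fun y hy c hc hyc => hS _ ?_ c hc hyc⟩
    refine Submodule.sub_mem _ (Submodule.subset_span (Set.mem_insert _ _)) ?_
    refine Submodule.span_mono (Set.subset_insert _ _) ?_
    exact Submodule.apply_mem_span_image_of_mem_span J.toLinearMap hy
  choose N hN1 hN using hN
  -- A term is (point, finite set of all points so far, index); each new point approximates `φ` on
  -- every earlier norming set, and the growing index sends the error to 0.
  obtain ⟨s, hs, hr⟩ := exists_seq_of_forall_finset_exists
    (α := X × Finset X × ℕ) (fun p => p.1 ∈ A ∧ p.1 ∈ p.2.1)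
    (fun p q => p.2.1 ⊆ q.2.1 ∧ p.2.2 < q.2.2 ∧
      ∀ f ∈ N p.2.1, |φ f - f q.1| < 1 / ((q.2.2 : ℝ) + 1)) (by
      intro t _
      let n := t.sup (fun p => p.2.2) + 1
      obtain ⟨a, ha, hat⟩ := exists_mem_approx_of_mem_closure hφ₀
        (t.biUnion fun p => N p.2.1) (Nat.one_div_pos_of_nat (α := ℝ) (n := n))
      refine ⟨(a, insert a (t.biUnion fun p => p.2.1), n), ⟨ha, Finset.mem_insert_self _ _⟩, ?_⟩
      intro p hp
      refine ⟨?_, ?_, ?_⟩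
      · exact (Finset.subset_biUnion_of_mem (fun p : X × Finset X × ℕ => p.2.1) hp).trans
          (Finset.subset_insert _ _)
      · exact Nat.lt_succ_of_le (Finset.le_sup (f := fun p : X × Finset X × ℕ => p.2.2) hp)
      · exact fun f hf => hat f (Finset.mem_biUnion.2 ⟨p, hp, hf⟩))
  have hmono : Monotone fun n => (s n).2.1 :=
    monotone_nat_of_le_succ fun n => (hr n (n + 1) n.lt_succ_self).1
  have hlt : StrictMono fun n => (s n).2.2 :=
    strictMono_nat_of_lt_succ fun n => (hr n (n + 1) n.lt_succ_self).2.1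
  obtain ⟨ψ, hψ, z, hz⟩ := h (fun n => (s n).1) fun n => (hs n).1
  have hlim : ∀ m, ∀ f ∈ N (s m).2.1, φ f = f z := by
    intro m f hf
    have h1 : Tendsto (fun n => f (s n).1) atTop (𝓝 (φ f)) := by
      rw [tendsto_iff_dist_tendsto_zero]
      refine squeeze_zero' (Eventually.of_forall fun _ => dist_nonneg) ?_
        (tendsto_one_div_add_atTop_nhds_zero_nat (𝕜 := ℝ))
      filter_upwards [eventually_gt_atTop m] with n hn
      rw [dist_comm, Real.dist_eq]
      refine ((hr m n hn).2.2 f hf).le.trans (Nat.one_div_le_one_div (hlt.id_le n))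
    exact tendsto_nhds_unique (h1.comp hψ.tendsto_atTop) (hz f)
  let W : ℕ → Submodule ℝ X := fun n => Submodule.span ℝ ((s n).2.1 : Set X)
  have hWmono : Monotone W := fun m n hmn =>
    Submodule.span_mono (Finset.coe_subset.2 (hmono hmn))
  have hzW : z ∈ closure ((⨆ n, W n : Submodule ℝ X) : Set X) :=
    mem_closure_of_tendsto_weak _ (fun n => Submodule.mem_iSup_of_mem (ψ n)
      (Submodule.subset_span (hs (ψ n)).2)) hz
  refine ⟨toWeakSpace ℝ X z, ?_⟩
  suffices hφz : φ = J z by rw [hφz]; rfl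
  refine sub_eq_zero.1 (norm_le_zero_iff.1 ?_)
  refine le_of_forall_pos_le_add fun ε hε => ?_
  obtain ⟨y, hy, hzy⟩ := Metric.mem_closure_iff.1 hzW (ε / 3) (by positivity)
  obtain ⟨m, hm⟩ := (Submodule.mem_iSup_of_directed W hWmono.directed_le).1 hy
  rw [dist_eq_norm] at hzy
  -- On the norming set of `W m`, `φ` agrees with `z`, so there `φ - J y` is bounded by `‖z - y‖`.
  have h1 : ‖φ - J y‖ ≤ 2 * (ε / 3) := by
    refine hN _ y hm _ (by positivity) fun f hf => ?_
    rw [hlim m f hf, ← map_sub, ← Real.norm_eq_abs]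
    calc ‖f (z - y)‖ ≤ ‖f‖ * ‖z - y‖ := f.le_opNorm _
      _ ≤ 1 * ‖z - y‖ := by gcongr; exact hN1 _ f hf
      _ ≤ ε / 3 := by linarith
  have h2 : ‖J (z - y)‖ ≤ ε / 3 := (NormedSpace.double_dual_bound ℝ X _).trans hzy.le
  have h3 : φ - J z = (φ - J y) - J (z - y) := by rw [map_sub]; abel
  rw [h3]
  linarith [norm_sub_le (φ - J y) (J (z - y))]

end WeakCompactness

/-! ### Unbounded convergence on order bounded sets -/

/-- The triangle inequality makes `u + |z|` a truncation level that never cuts; `z` itself need not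
satisfy the bound. -/
theorem abs_sub_inf_eq_of_abs_le {F : Type*} [AddCommGroup F] [Lattice F] [IsOrderedAddMonoid F]
    {a z u : F} (ha : |a| ≤ u) : |a - z| ⊓ (u + |z|) = |a - z| :=
  inf_eq_left.2 (by
    simpa [sub_eq_add_neg] using (abs_add_le a (-z)).trans (add_le_add_left ha |-z|))

section UnboundedConvergence

variable {F : Type*} [NormedAddCommGroup F] [Lattice F] [IsOrderedAddMonoid F]
  {ι : Type*} {l : Filter ι} {y : ι → F} {z u : F}

/-- On order bounded sets, `un`-convergence is norm convergence. -/
theorem UnTendsto.tendsto_of_abs_le [HasSolidNorm F] (h : UnTendsto y l z)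
    (hy : ∀ᶠ i in l, |y i| ≤ u) (hu : 0 ≤ u) : Tendsto y l (𝓝 z) := by
  rw [tendsto_iff_norm_sub_tendsto_zero]
  refine (h (u + |z|) (add_nonneg hu (abs_nonneg z))).congr' ?_
  filter_upwards [hy] with i hi
  rw [abs_sub_inf_eq_of_abs_le hi, norm_abs_eq_norm]

/-- On order bounded sets, `uaw`-convergence implies weak convergence. -/
theorem UawTendsto.tendsto_of_abs_le [HasSolidNorm F] [NormedSpace ℝ F] [IsOrderedModule ℝ F]
    (h : UawTendsto y l z) (hy : ∀ᶠ i in l, |y i| ≤ u) (hu : 0 ≤ u) (f : F →L[ℝ] ℝ) :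
    Tendsto (fun i => f (y i)) l (𝓝 (f z)) := by
  obtain ⟨g, -, hfg⟩ := exists_positive_dominating f
  have h1 := (tendsto_toWeakSpace_zero_iff _ _).1 (h (u + |z|) (add_nonneg hu (abs_nonneg z))) g
  rw [tendsto_iff_dist_tendsto_zero]
  refine squeeze_zero' (Eventually.of_forall fun _ => dist_nonneg) ?_ h1
  filter_upwards [hy] with i hi
  rw [abs_sub_inf_eq_of_abs_le hi, Real.dist_eq, ← map_sub]
  exact hfg _

end UnboundedConvergence

/-! ### Images of order intervals and transfer of compactness -/

/-- An order bounded operator maps an order interval, up to a positive scalar, into an order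
interval and into the image of the unit ball. -/
theorem IsOrderBoundedOperator.exists_smul_mem {E F : Type*} [NormedAddCommGroup E]
    [NormedSpace ℝ E] [Lattice E] [IsOrderedAddMonoid E] [HasSolidNorm E] [NormedAddCommGroup F]
    [NormedSpace ℝ F] [Lattice F] [IsOrderedAddMonoid F] [IsOrderedModule ℝ F] {T : E →ₗ[ℝ] F}
    (hT : IsOrderBoundedOperator T) (a b : E) :
    ∃ c : ℝ, 0 < c ∧ ∃ u : F, 0 ≤ u ∧ ∀ y ∈ T '' Set.Icc a b,
      |c • y| ≤ u ∧ c • y ∈ T '' Metric.closedBall (0 : E) 1 := by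
  obtain ⟨⟨v, hv⟩, ⟨w, hw⟩⟩ := hT (Set.Icc a b) bddBelow_Icc bddAbove_Icc
  -- The `+ 1` keeps the scaling factor positive when `a = b = 0`.
  have hM : 0 < ‖|a| + |b|‖ + 1 := by positivity
  have hc : 0 < (‖|a| + |b|‖ + 1)⁻¹ := inv_pos.2 hM
  refine ⟨_, hc, (‖|a| + |b|‖ + 1)⁻¹ • (|v| + |w|),
    smul_nonneg hc.le (add_nonneg (abs_nonneg v) (abs_nonneg w)), fun y hy => ⟨?_, ?_⟩⟩
  · refine abs_le'.2 ⟨?_, ?_⟩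
    · refine smul_le_smul_of_nonneg_left ?_ hc.le
      exact ((hw hy).trans (le_abs_self w)).trans (le_add_of_nonneg_left (abs_nonneg v))
    · rw [← smul_neg]
      refine smul_le_smul_of_nonneg_left ?_ hc.le
      exact ((neg_le_neg (hv hy)).trans (neg_le_abs v)).trans (le_add_of_nonneg_right (abs_nonneg w))
  · obtain ⟨x, hx, rfl⟩ := hy
    refine ⟨(‖|a| + |b|‖ + 1)⁻¹ • x, ?_, map_smul _ _ _⟩
    have hxab : |x| ≤ |(|a| + |b|)| := by
      rw [abs_of_nonneg (add_nonneg (abs_nonneg a) (abs_nonneg b))]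
      refine abs_le'.2 ⟨?_, ?_⟩
      · exact (hx.2.trans (le_abs_self b)).trans (le_add_of_nonneg_left (abs_nonneg a))
      · exact ((neg_le_neg hx.1).trans (neg_le_abs a)).trans
          (le_add_of_nonneg_right (abs_nonneg b))
    have hn := norm_le_norm_of_abs_le_abs hxab
    rw [mem_closedBall_zero_iff, norm_smul, norm_inv, Real.norm_of_nonneg hM.le,
      inv_mul_le_iff₀ hM]
    linarith

/-- In a metric space, a set in which every sequence has a convergent subsequence is relatively
compact. -/
theorem isCompact_closure_of_forall_seq {X : Type*} [MetricSpace X] {A : Set X}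
    (h : ∀ y : ℕ → X, (∀ n, y n ∈ A) → ∃ ψ : ℕ → ℕ, StrictMono ψ ∧
      ∃ z : X, Tendsto (y ∘ ψ) atTop (𝓝 z)) : IsCompact (closure A) := by
  refine IsSeqCompact.isCompact fun x hx => ?_
  -- Points of the closure are replaced by points of `A` within `1 / (n + 1)`, which does not change
  -- limits.
  choose y hyA hy using fun n : ℕ =>
    Metric.mem_closure_iff.1 (hx n) _ (Nat.one_div_pos_of_nat (α := ℝ) (n := n))
  obtain ⟨ψ, hψ, z, hz⟩ := h y hyA
  refine ⟨z, ?_, ψ, hψ, ?_⟩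
  · exact mem_closure_of_tendsto hz (Eventually.of_forall fun n => hyA _)
  · refine (tendsto_iff_of_dist ?_).1 hz
    refine squeeze_zero (fun _ => dist_nonneg) (fun n => ?_)
      ((tendsto_one_div_add_atTop_nhds_zero_nat (𝕜 := ℝ)).comp hψ.tendsto_atTop)
    rw [dist_comm]
    exact (hy (ψ n)).le

theorem mainTheorem11 {E F : Type*}
    [NormedAddCommGroup E] [NormedSpace ℝ E] [Lattice E] [IsOrderedAddMonoid E]
    [IsOrderedModule ℝ E] [HasSolidNorm E] [CompleteSpace E]
    [NormedAddCommGroup F] [NormedSpace ℝ F] [Lattice F] [IsOrderedAddMonoid F]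
    [IsOrderedModule ℝ F] [HasSolidNorm F] [CompleteSpace F]
    (T : E →ₗ[ℝ] F) (hT : IsOrderBoundedOperator T) :
    (IsSeqUnCompactOperator T → IsAMCompactOperator T) ∧
    (IsUawCompactOperator T → IsOrderWeaklyCompactOperator T) ∧
    (IsSeqUawCompactOperator T → IsOrderWeaklyCompactOperator T) := by
  have hbdd : ∀ (a b : E) (c : ℝ) (u : F), 0 < c → (∀ y ∈ T '' Set.Icc a b, |c • y| ≤ u) →
      Bornology.IsBounded (T '' Set.Icc a b) := by
    intro a b c u hc h
    refine isBounded_iff_forall_norm_le.2 ⟨c⁻¹ * ‖u‖, fun y hy => ?_⟩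
    have h1 := norm_le_norm_of_abs_le_abs ((h y hy).trans (le_abs_self u))
    rw [norm_smul, Real.norm_of_nonneg hc.le] at h1
    rwa [le_inv_mul_iff₀ hc]
  refine ⟨fun h a b => ?_, fun h a b => ?_, fun h a b => ?_⟩ <;>
    obtain ⟨c, hc, u, hu, hcu⟩ := hT.exists_smul_mem a b
  · refine isCompact_closure_of_forall_seq fun y hy => ?_
    obtain ⟨ψ, hψ, z, hz⟩ := h (fun n => c • y n) fun n => (hcu _ (hy n)).2
    refine ⟨ψ, hψ, c⁻¹ • z, ?_⟩
    have h1 := hz.tendsto_of_abs_le (Eventually.of_forall fun n => (hcu _ (hy (ψ n))).1) hu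
    simpa [Function.comp_def, hc.ne'] using h1.const_smul c⁻¹
  · refine isCompact_closure_weak_of_ultrafilter (hbdd a b c u hc fun y hy => (hcu y hy).1)
      fun U hU => ?_
    -- Shadows the norm topology, so that the ultrafilter criterion is read in the uaw-topology.
    let _ : TopologicalSpace F := uawTopology F
    obtain ⟨z, -, hz⟩ := isCompact_iff_ultrafilter_le_nhds.1 h (U.map fun y => c • y)
      (le_principal_iff.2 (Ultrafilter.mem_map.2
        (mem_of_superset hU fun y hy => subset_closure (hcu y hy).2)))
    refine ⟨c⁻¹ • z, fun f => tendsto_apply_of_tendsto_smul (y := id) hc f ?_⟩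
    exact ((tendsto_uawTopology_iff (fun y : F => c • y) (U : Filter F) z).1 hz).tendsto_of_abs_le
      (mem_of_superset hU fun y hy => (hcu y hy).1) hu f
  · refine isCompact_closure_weak_of_seq (hbdd a b c u hc fun y hy => (hcu y hy).1)
      fun y hy => ?_
    obtain ⟨ψ, hψ, z, hz⟩ := h (fun n => c • y n) fun n => (hcu _ (hy n)).2
    refine ⟨ψ, hψ, c⁻¹ • z, fun f => tendsto_apply_of_tendsto_smul (y := fun n => y (ψ n)) hc f ?_⟩
    exact hz.tendsto_of_abs_le (Eventually.of_forall fun n => (hcu _ (hy (ψ n))).1) hu f
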